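/- Let $M$ be a connected matroid on a finite ground set $E$ with rank function $r$, where a connected matroid is one with non-empty ground set that is not a direct sum of two matroids with non-empty ground sets. Let $\mathcal I(M)$ and $\mathcal B(M)$ be its families of independent sets and of bases, let $M^*$ be the dual matroid, with rank function $r^*$, and let $A\subseteq E$, $A^c=E\setminus A$. Write $(A,a)_==\{I\subseteq E:|I\cap A|=a\}$, and define $(A,a)_\le$, $(A,a)_<$, $(A,a)_>$ analogously. For $\mathcal S=\mathcal I(M)$ or $\mathcal S=\mathcal B(M)$, a face of $\mathcal S$ is a family $\mathcal S\cap\bigcap_i (A_i,r(A_i))_=$ with $A_i\subseteq E$; a facet is an inclusion-maximal face among the faces different from $\mathcal S$; and $(A,r(A))_\le$ is facet-defining for $\mathcal S$ if $\mathcal S\cap(A,r(A))_=$ is a facet of $\mathcal S$. Facet-defining inequalities for $\mathcal I(M^*)$ are defined in the same way, using $r^*$. Call $(A,r(A))_\le$ non-trivial if both $(E,r(E))_=\cap(A,r(A))_>$ and $(E,r(E))_=\cap(A,r(A))_<$ are non-empty. Consider the following conditions. (a) $(A,r(A))_\le$ is facet-defining for $\mathcal B(M)$. (b) $\mathcal B(M)\cap(A,r(A))_=$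 is the family of bases of a matroid on $E$ whose connected components are exactly the two sets $A$ and $A^c$. (c) The restriction $M|A$ and the contraction $M/A$ are both connected. (d) $(A,r(A))_\le$ is facet-defining for $\mathcal I(M)$, and $(A^c,r^*(A^c))_\le$ is facet-defining for $\mathcal I(M^*)$. Then (a), (b) and (c) are equivalent. If $(A,r(A))_\le$ is non-trivial, then all four conditions (a), (b), (c), (d) are equivalent. If $(A,r(A))_\le$ is not non-trivial, then (d) fails. -/

import Mathlib

open Set

namespace MatroidFacet

/-- The independence system `I(M)`: the family of independent sets of `M`. -/
def indepSystem {α : Type*} (M : Matroid α) : Set (Set α) := {I | M.Indep I}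

/-- The base system `B(M)`: the family of bases of `M`. -/
def baseSystem {α : Type*} (M : Matroid α) : Set (Set α) := {B | M.IsBase B}

/-- `(A, a)_=`: the subsets of the ground set `E` meeting `A` in exactly `a` elements. -/
def levelEq {α : Type*} (E A : Set α) (a : ℕ∞) : Set (Set α) :=
  {I | I ⊆ E ∧ (I ∩ A).encard = a}

/-- `(A, a)_>`: the subsets of the ground set `E` meeting `A` in more than `a` elements. -/
def levelGT {α : Type*} (E A : Set α) (a : ℕ∞) : Set (Set α) :=
  {I | I ⊆ E ∧ a < (I ∩ A).encard}

/-- `(A, a)_<`: the subsets of the ground set `E` meeting `A` in fewer than `a` elements. -/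
def levelLT {α : Type*} (E A : Set α) (a : ℕ∞) : Set (Set α) :=
  {I | I ⊆ E ∧ (I ∩ A).encard < a}

/-- `S ∩ (A, r(A))_=`, where `r` is the rank function of `M`; it is used with `S = I(M)` and with
`S = B(M)`. -/
def faceOf {α : Type*} (M : Matroid α) (S : Set (Set α)) (A : Set α) : Set (Set α) :=
  S ∩ levelEq M.E A (M.eRk A)

/-- `F` is a face of `S` (with `S = I(M)` or `S = B(M)`): `F = S ∩ ⋂ᵢ (Aᵢ, r(Aᵢ))_=` for some
family of subsets `Aᵢ` of the ground set. -/
def IsFace {α : Type*} (M : Matroid α) (S F : Set (Set α)) : Prop :=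
  ∃ 𝒜 : Set (Set α), (∀ A ∈ 𝒜, A ⊆ M.E) ∧ F = S ∩ ⋂ A ∈ 𝒜, levelEq M.E A (M.eRk A)

/-- A facet of `S` is an inclusion-maximal face among the proper faces. -/
def IsFacet {α : Type*} (M : Matroid α) (S F : Set (Set α)) : Prop :=
  Maximal (fun G => IsFace M S G ∧ G ≠ S) F

/-- `(A, r(A))_≤` is a facet-defining inequality of the independence system `I(M)`. -/
def IndepFacetDefining {α : Type*} (M : Matroid α) (A : Set α) : Prop :=
  IsFacet M (indepSystem M) (faceOf M (indepSystem M) A)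

/-- `(A, r(A))_≤` is a facet-defining inequality of the base system `B(M)`. -/
def BaseFacetDefining {α : Type*} (M : Matroid α) (A : Set α) : Prop :=
  IsFacet M (baseSystem M) (faceOf M (baseSystem M) A)

/-- `(A, r(A))_≤` is non-trivial: both `(E, r(E))_= ∩ (A, r(A))_>` and
`(E, r(E))_= ∩ (A, r(A))_<` are non-empty. -/
def NonTrivialIneq {α : Type*} (M : Matroid α) (A : Set α) : Prop :=
  (levelEq M.E M.E (M.eRk M.E) ∩ levelGT M.E A (M.eRk A)).Nonempty ∧
    (levelEq M.E M.E (M.eRk M.E) ∩ levelLT M.E A (M.eRk A)).Nonempty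

/-- `X` is a separator of `M`: `M` is the direct sum of a matroid on `X` and a matroid on the
complement of `X` in the ground set. -/
def IsSeparator {α : Type*} (M : Matroid α) (X : Set α) : Prop :=
  ∃ (M₁ M₂ : Matroid α) (h : Disjoint M₁.E M₂.E), M₁.E = X ∧ M = M₁.disjointSum M₂ h

/-- `M` is connected: its ground set is non-empty, and `M` is not a direct sum of two matroids
with non-empty ground sets. -/
def IsConnected {α : Type*} (M : Matroid α) : Prop :=
  M.E.Nonempty ∧
    ¬ ∃ (M₁ M₂ : Matroid α) (h : Disjoint M₁.E M₂.E),
      M₁.E.Nonempty ∧ M₂.E.Nonempty ∧ M = M₁.disjointSum M₂ h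

/-- The connected components of `M`: the minimal non-empty separators. -/
def components {α : Type*} (M : Matroid α) : Set (Set α) :=
  {C | Minimal (fun X => X.Nonempty ∧ IsSeparator M X) C}

/-- The set family `F` is the base system of a matroid on `E`, and the set of connected components
of that matroid is `𝒞`. (A matroid is determined by its ground set and its bases.) -/
def IsBaseSystemWithComponents {α : Type*} (E : Set α) (F 𝒞 : Set (Set α)) : Prop :=
  ∃ N : Matroid α, N.E = E ∧ baseSystem N = F ∧ components N = 𝒞

end MatroidFacet

namespace MatroidFacet

/-! Write r for the rank function. The argument rests on one equivalence: X is a separator exactly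
when r(X) + r(E \ X) ≤ r(E), and exactly when all bases meet X in the same number of elements.

Its relative version handles faces. If all bases in the face of X meet Y in k elements, a greedily
built base yields the inequality `add_rk_sdiff_add_rk_union_compl_le`. Applied to Y and to its
complement, it shows that Y induces separators of M|X and M/X
(`rk_restrict_contract_le_of_forall_ncard_inter_eq`).

If M|A and M/A are connected, a face containing that of A can therefore only come from ∅, A, the
complement of A, or E, and connectedness of M leaves A as the only proper choice. Conversely, a
non-trivial separator of M|A or M/A gives a proper face containing that of A; were the two equal,
the greedy inequality would produce a separator of M. Condition (b) fits in because the face of A is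
the base system of the direct sum of M|A and M/A.

For independent sets, a facet has connected restriction, and a closed set of positive rank with
connected restriction gives a facet. The dual of M/A is the restriction of M* to the complement of
A, so (d) is the independence criterion used on both sides of duality. Non-triviality amounts to 0 <
r(A) < r(E) together with the same bounds for the complement in M*. -/

/-- The rank of a set, as a natural number. -/
noncomputable def rk {α : Type*} (M : Matroid α) (X : Set α) : ℕ := (M.eRk X).toNat

/-! ### Integer-valued rank, duality and contraction. -/

section Rank

variable {α : Type*} {M : Matroid α} [M.Finite] {I X Y A B : Set α}

theorem coe_rk (M : Matroid α) [M.Finite] (X : Set α) : (rk M X : ℕ∞) = M.eRk X :=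
  ENat.natCast_toNat (Matroid.eRk_ne_top_iff.2 (Matroid.isRkFinite_set M X))

theorem coe_ncard (hX : X ⊆ M.E) : (X.ncard : ℕ∞) = X.encard :=
  (M.set_finite X hX).cast_ncard_eq

theorem ncard_eq_rk_of_isBasis (h : M.IsBasis I X) : I.ncard = rk M X := by
  have := h.encard_eq_eRk
  rw [← coe_rk, ← coe_ncard h.indep.subset_ground] at this
  exact_mod_cast this

theorem ncard_eq_rk_ground (h : M.IsBase B) : B.ncard = rk M M.E :=
  ncard_eq_rk_of_isBasis h.isBasis_ground

theorem ncard_le_rk (hI : M.Indep I) (h : I ⊆ X) : I.ncard ≤ rk M X := by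
  have := hI.encard_le_eRk_of_subset h
  rw [← coe_rk, ← coe_ncard hI.subset_ground] at this
  exact_mod_cast this

theorem isBasis_of_rk_le_ncard (hI : M.Indep I) (h : I ⊆ X) (hX : X ⊆ M.E)
    (hr : rk M X ≤ I.ncard) : M.IsBasis I X := by
  refine hI.isBasis_of_eRk_ge (M.set_finite I hI.subset_ground) h ?_
  rw [hI.eRk_eq_encard, ← coe_rk, ← coe_ncard hI.subset_ground]
  exact_mod_cast hr

theorem isBase_of_rk_le_ncard (hI : M.Indep I) (hr : rk M M.E ≤ I.ncard) : M.IsBase I :=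
  Matroid.isBasis_ground_iff.1 (isBasis_of_rk_le_ncard hI hI.subset_ground Subset.rfl hr)

theorem rk_mono (M : Matroid α) [M.Finite] (h : X ⊆ Y) : rk M X ≤ rk M Y := by
  have := M.eRk_mono h
  rw [← coe_rk, ← coe_rk] at this
  exact_mod_cast this

theorem rk_union_le (M : Matroid α) [M.Finite] (X Y : Set α) :
    rk M (X ∪ Y) ≤ rk M X + rk M Y := by
  have := M.eRk_union_le_eRk_add_eRk X Y
  simp only [← coe_rk] at this
  exact_mod_cast this

theorem rk_inter_add_rk_union_le (M : Matroid α) [M.Finite] (X Y : Set α) :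
    rk M (X ∩ Y) + rk M (X ∪ Y) ≤ rk M X + rk M Y := by
  have := M.eRk_inter_add_eRk_union_le X Y
  simp only [← coe_rk] at this
  exact_mod_cast this

theorem rk_le_ncard (hX : X ⊆ M.E) : rk M X ≤ X.ncard := by
  have := M.eRk_le_encard X
  rw [← coe_rk, ← coe_ncard hX] at this
  exact_mod_cast this

theorem rk_dual_add (hX : X ⊆ M.E) :
    rk M.dual X + rk M M.E = rk M (M.E \ X) + X.ncard := by
  have := M.eRk_dual_add_eRank X hX
  rw [← M.eRk_ground, ← coe_ncard hX] at this
  simp only [← coe_rk] at this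
  exact_mod_cast this

theorem indep_iff_rk (hX : X ⊆ M.E) : M.Indep X ↔ rk M X = X.ncard := by
  rw [Matroid.indep_iff_eRk_eq_encard, ← coe_rk, ← coe_ncard hX]
  exact_mod_cast Iff.rfl

theorem rk_restrict (M : Matroid α) (h : X ⊆ A) : rk (M.restrict A) X = rk M X := by
  rw [rk, rk, M.restrict_eRk_eq h]

theorem ncard_inter_add_ncard_inter_compl (hB : B ⊆ M.E) (X : Set α) :
    (B ∩ X).ncard + (B ∩ (M.E \ X)).ncard = B.ncard := by
  have h : B ∩ (M.E \ X) = B \ X := by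
    ext x
    exact ⟨fun h => ⟨h.1, h.2.2⟩, fun h => ⟨h.1, hB h.1, h.2⟩⟩
  rw [h, ncard_inter_add_ncard_sdiff_eq_ncard B X (M.set_finite B hB)]

/-- Every basis of `X` extends to a base meeting `X` in that basis. -/
theorem exists_isBase_ncard_inter (hX : X ⊆ M.E) :
    ∃ B, M.IsBase B ∧ (B ∩ X).ncard = rk M X := by
  obtain ⟨I, hI⟩ := M.exists_isBasis X
  obtain ⟨B, hB, rfl⟩ := hI.exists_isBase
  exact ⟨B, hB, ncard_eq_rk_of_isBasis hI⟩

/-- Contraction is the dual of deletion in the dual, so three uses of the dual rank formula for M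
and one for the deletion reduce this to arithmetic. -/
theorem rk_contract_add (hA : A ⊆ M.E) (hX : X ⊆ M.E \ A) :
    rk (M.contract A) X + rk M A = rk M (X ∪ A) := by
  have hXE : X ⊆ M.E := hX.trans sdiff_subset
  have h1 := rk_dual_add (M := M.dual.delete A) (X := X) hX
  have h2 := rk_dual_add (M := M) (X := (M.E \ A) \ X) (sdiff_subset.trans sdiff_subset)
  have h3 := rk_dual_add (M := M) (X := M.E \ A) sdiff_subset
  have h4 : rk (M.dual.delete A) (M.E \ A) = rk M.dual (M.E \ A) := rk_restrict _ Subset.rfl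
  have h5 : rk (M.dual.delete A) ((M.E \ A) \ X) = rk M.dual ((M.E \ A) \ X) :=
    rk_restrict _ sdiff_subset
  have h6 : M.E \ ((M.E \ A) \ X) = X ∪ A := by
    ext x
    have := @hXE x
    have := @hA x
    simp only [mem_sdiff, mem_union]
    tauto
  have h7 : M.E \ (M.E \ A) = A := by rw [sdiff_sdiff_cancel_left hA]
  have h8 := ncard_sdiff_add_ncard_of_subset hX (M.set_finite _ sdiff_subset)
  rw [Matroid.delete_ground, Matroid.dual_ground] at h1
  rw [h6] at h2
  rw [h7] at h3
  rw [← Matroid.dual_delete_dual]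
  omega

end Rank

/-! ### Faces and facets given by a single inequality. -/

section Faces

variable {α : Type*} {M : Matroid α} {S : Set (Set α)} {A B : Set α}

theorem mem_levelEq_iff [M.Finite] (hB : B ⊆ M.E) :
    B ∈ levelEq M.E A (M.eRk A) ↔ (B ∩ A).ncard = rk M A := by
  rw [levelEq, mem_ofPred_eq, and_iff_right hB, ← coe_rk,
    ← coe_ncard (M := M) (inter_subset_left.trans hB)]
  exact_mod_cast Iff.rfl

theorem mem_faceOf_baseSystem [M.Finite] :
    B ∈ faceOf M (baseSystem M) A ↔ M.IsBase B ∧ (B ∩ A).ncard = rk M A :=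
  and_congr_right fun h => mem_levelEq_iff (M := M) (Matroid.IsBase.subset_ground h)

theorem mem_faceOf_indepSystem [M.Finite] :
    B ∈ faceOf M (indepSystem M) A ↔ M.Indep B ∧ (B ∩ A).ncard = rk M A :=
  and_congr_right fun h => mem_levelEq_iff (M := M) (Matroid.Indep.subset_ground h)

/-- A face given by a single inequality is a facet as soon as it is maximal among the proper faces
given by a single inequality. -/
theorem isFacet_faceOf_iff (hA : A ⊆ M.E) :
    IsFacet M S (faceOf M S A) ↔ faceOf M S A ≠ S ∧
      ∀ Y ⊆ M.E, faceOf M S Y ≠ S → faceOf M S A ⊆ faceOf M S Y →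
        faceOf M S Y ⊆ faceOf M S A := by
  have hface : ∀ Y ⊆ M.E, IsFace M S (faceOf M S Y) := fun Y hY =>
    ⟨{Y}, by simpa using hY, by simp [faceOf]⟩
  refine ⟨fun h => ⟨h.prop.2, fun Y hY hne hle => h.le_of_ge ⟨hface Y hY, hne⟩ hle⟩,
    fun ⟨hne, hmax⟩ => ⟨⟨hface A hA, hne⟩, ?_⟩⟩
  rintro G ⟨⟨𝒜, h𝒜, rfl⟩, hG⟩ hle
  -- A proper face has at least one proper defining inequality, and it lies inside the face of that
  -- inequality.
  obtain ⟨Y, hY, hYS⟩ : ∃ Y ∈ 𝒜, faceOf M S Y ≠ S := by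
    by_contra! hcon
    refine hG (inter_eq_left.2 (subset_iInter₂ fun Y hY => ?_))
    exact inter_eq_left.1 (hcon Y hY)
  have hsub : S ∩ ⋂ A ∈ 𝒜, levelEq M.E A (M.eRk A) ⊆ faceOf M S Y :=
    inter_subset_inter_right _ (biInter_subset_of_mem hY)
  exact hsub.trans (hmax Y (h𝒜 Y hY) hYS (hle.trans hsub))

end Faces

/-! ### Separators and connectedness in terms of rank. -/

section Connectivity

variable {α : Type*} {M : Matroid α} {A B X Y : Set α}

theorem IsSeparator.subset_ground (h : IsSeparator M X) : X ⊆ M.E := by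
  obtain ⟨M₁, M₂, hd, rfl, rfl⟩ := h
  simp

theorem IsSeparator.exists_forall_ncard_inter_eq [M.Finite] (h : IsSeparator M X) :
    ∃ k, ∀ B, M.IsBase B → (B ∩ X).ncard = k := by
  obtain ⟨B₀, hB₀⟩ := M.exists_isBase
  refine ⟨(B₀ ∩ X).ncard, fun B hB => ?_⟩
  obtain ⟨M₁, M₂, hd, rfl, rfl⟩ := h
  rw [Matroid.disjointSum_isBase_iff] at hB hB₀
  rw [ncard, ncard, hB.1.encard_eq_eRank, hB₀.1.encard_eq_eRank]

/-- Some base has full rank on X and another has full rank on the complement; since the count on X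
is constant, the second base is full on both sides. -/
theorem rk_add_rk_compl_le_of_forall_ncard_inter_eq [M.Finite] (hX : X ⊆ M.E) {k : ℕ}
    (h : ∀ B, M.IsBase B → (B ∩ X).ncard = k) : rk M X + rk M (M.E \ X) ≤ rk M M.E := by
  obtain ⟨B, hB, hBX⟩ := exists_isBase_ncard_inter (M := M) hX
  obtain ⟨B', hB', hBX'⟩ := exists_isBase_ncard_inter (M := M) (X := M.E \ X) sdiff_subset
  have h1 := h B hB
  have h2 := h B' hB'
  have h3 := ncard_inter_add_ncard_inter_compl hB'.subset_ground X
  have h4 := ncard_eq_rk_ground hB'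
  omega

/-- Bases of X and of its complement have a spanning union with at most r(E) elements. Such a union
is independent, so independence can be tested on the two sides separately. -/
theorem isSeparator_of_rk_add_rk_compl_le [M.Finite] (hX : X ⊆ M.E)
    (h : rk M X + rk M (M.E \ X) ≤ rk M M.E) : IsSeparator M X := by
  have hd : Disjoint (M.restrict X).E (M.restrict (M.E \ X)).E := by
    simpa only [Matroid.restrict_ground_eq] using disjoint_sdiff_right
  refine ⟨M.restrict X, M.restrict (M.E \ X), hd, rfl, ?_⟩
  refine Matroid.ext_indep (by simp [union_eq_right.2 hX]) fun I hI => ?_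
  simp only [Matroid.disjointSum_indep_iff, Matroid.restrict_indep_iff,
    Matroid.restrict_ground_eq, inter_subset_right, and_true, union_sdiff_cancel hX]
  refine ⟨fun h => ⟨h.inter_right _, h.inter_right _, hI⟩, fun ⟨h1, h2, _⟩ => ?_⟩
  obtain ⟨J₁, hJ₁, hIJ₁⟩ := h1.subset_isBasis_of_subset inter_subset_right hX
  obtain ⟨J₂, hJ₂, hIJ₂⟩ := h2.subset_isBasis_of_subset inter_subset_right sdiff_subset
  have hJE : J₁ ∪ J₂ ⊆ M.E := union_subset hJ₁.indep.subset_ground hJ₂.indep.subset_ground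
  have hspan : M.Spanning (J₁ ∪ J₂) := by
    rw [Matroid.spanning_iff_ground_subset_closure hJE]
    intro x hx
    by_cases hxX : x ∈ X
    · exact M.closure_subset_closure subset_union_left (hJ₁.subset_closure hxX)
    · exact M.closure_subset_closure subset_union_right (hJ₂.subset_closure ⟨hx, hxX⟩)
  have hle : (J₁ ∪ J₂).ncard ≤ rk M (J₁ ∪ J₂) := by
    have h3 := ncard_union_le J₁ J₂
    have h4 := ncard_eq_rk_of_isBasis hJ₁
    have h5 := ncard_eq_rk_of_isBasis hJ₂
    have h6 : rk M (J₁ ∪ J₂) = rk M M.E := by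
      rw [rk, rk, hspan.eRk_eq, M.eRk_ground]
    omega
  refine ((indep_iff_rk hJE).2 ((rk_le_ncard hJE).antisymm hle)).subset fun x hx => ?_
  by_cases hxX : x ∈ X
  · exact Or.inl (hIJ₁ ⟨hx, hxX⟩)
  · exact Or.inr (hIJ₂ ⟨hx, hI hx, hxX⟩)

theorem isSeparator_iff_rk [M.Finite] :
    IsSeparator M X ↔ X ⊆ M.E ∧ rk M X + rk M (M.E \ X) ≤ rk M M.E := by
  refine ⟨fun h => ⟨h.subset_ground, ?_⟩, fun h => isSeparator_of_rk_add_rk_compl_le h.1 h.2⟩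
  obtain ⟨k, hk⟩ := h.exists_forall_ncard_inter_eq
  exact rk_add_rk_compl_le_of_forall_ncard_inter_eq h.subset_ground hk

theorem isConnected_iff_rk [M.Finite] :
    IsConnected M ↔ M.E.Nonempty ∧
      ∀ X ⊆ M.E, rk M X + rk M (M.E \ X) ≤ rk M M.E → X = ∅ ∨ X = M.E := by
  refine and_congr_right fun _ => ⟨fun h X hX hr => ?_, ?_⟩
  · obtain ⟨M₁, M₂, hd, rfl, hM⟩ := isSeparator_of_rk_add_rk_compl_le hX hr
    by_contra! hcon
    refine h ⟨M₁, M₂, hd, hcon.1, ?_, hM⟩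
    rw [nonempty_iff_ne_empty]
    intro h0
    exact hcon.2 (by rw [hM, Matroid.disjointSum_ground_eq, h0, union_empty])
  · rintro h ⟨M₁, M₂, hd, h1, h2, hM⟩
    obtain ⟨hE, hr⟩ := isSeparator_iff_rk.1 (⟨M₁, M₂, hd, rfl, hM⟩ : IsSeparator M M₁.E)
    obtain h0 | h0 := h _ hE hr
    · exact h1.ne_empty h0
    · refine h2.ne_empty (hd.eq_bot_of_ge ?_)
      rw [h0, hM, Matroid.disjointSum_ground_eq]
      exact subset_union_right

theorem isConnected_restrict_iff_rk [M.Finite] (hA : A ⊆ M.E) :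
    IsConnected (M.restrict A) ↔ A.Nonempty ∧
      ∀ X ⊆ A, rk M X + rk M (A \ X) ≤ rk M A → X = ∅ ∨ X = A := by
  have : (M.restrict A).Finite := ⟨M.set_finite A hA⟩
  rw [isConnected_iff_rk, Matroid.restrict_ground_eq, rk_restrict M Subset.rfl]
  refine and_congr_right fun _ => forall₂_congr fun X hX => ?_
  rw [rk_restrict M hX, rk_restrict M sdiff_subset]

theorem isConnected_contract_iff_rk [M.Finite] (hA : A ⊆ M.E) :
    IsConnected (M.contract A) ↔ (M.E \ A).Nonempty ∧
      ∀ X ⊆ M.E \ A, rk M (A ∪ X) + rk M (M.E \ X) ≤ rk M M.E + rk M A →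
        X = ∅ ∨ X = M.E \ A := by
  rw [isConnected_iff_rk, Matroid.contract_ground]
  refine and_congr_right fun _ => forall₂_congr fun X hX => imp_congr_left ?_
  have h1 := rk_contract_add hA hX
  have h2 := rk_contract_add hA (X := (M.E \ A) \ X) sdiff_subset
  have h3 := rk_contract_add hA (X := M.E \ A) Subset.rfl
  have h4 : (M.E \ A) \ X ∪ A = M.E \ X := by
    ext x
    have := @hX x
    have := @hA x
    simp only [mem_sdiff, mem_union] at *
    tauto
  rw [union_comm] at h1
  rw [h4] at h2
  rw [sdiff_union_of_subset hA] at h3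
  omega

theorem IsConnected.dual [M.Finite] (h : IsConnected M) : IsConnected M.dual := by
  rw [isConnected_iff_rk] at h ⊢
  refine ⟨h.1, fun X hX hr => h.2 X hX ?_⟩
  rw [Matroid.dual_ground] at hX hr
  have h1 := rk_dual_add hX
  have h2 := rk_dual_add (M := M) (X := M.E \ X) sdiff_subset
  have h3 := rk_dual_add (M := M) (X := M.E) Subset.rfl
  have h4 := ncard_sdiff_add_ncard_of_subset hX (M.set_finite _ Subset.rfl)
  have h5 : rk M (M.E \ M.E) = 0 := by simp [rk]
  rw [sdiff_sdiff_cancel_left hX] at h2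
  omega

theorem isConnected_dual_iff [M.Finite] : IsConnected M.dual ↔ IsConnected M :=
  ⟨fun h => M.dual_dual ▸ h.dual, fun h => h.dual⟩

theorem isConnected_dual_restrict_compl [M.Finite] :
    IsConnected (M.dual.restrict (M.E \ A)) ↔ IsConnected (M.contract A) := by
  rw [← isConnected_dual_iff (M := M.contract A), Matroid.dual_contract, Matroid.delete,
    Matroid.dual_ground]

theorem isConnected_dual_contract_compl [M.Finite] (hA : A ⊆ M.E) :
    IsConnected (M.dual.contract (M.E \ A)) ↔ IsConnected (M.restrict A) := by
  have : (M.restrict A).Finite := ⟨M.set_finite A hA⟩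
  rw [← isConnected_dual_iff (M := M.restrict A), ← M.dual_delete, Matroid.delete,
    sdiff_sdiff_cancel_left hA]

/-- In a connected matroid the only non-empty set of rank zero can be the ground set. -/
theorem IsConnected.eq_ground_of_rk_eq_zero [M.Finite] (hM : IsConnected M) (hX : X ⊆ M.E)
    (hne : X.Nonempty) (h : rk M X = 0) : X = M.E := by
  refine (((isConnected_iff_rk.1 hM).2 X hX ?_).resolve_left hne.ne_empty)
  have := rk_mono M (sdiff_subset (s := M.E) (t := X))
  omega

end Connectivity

/-! ### Sets met constantly by the bases of a face. -/

section BaseFaces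

variable {α : Type*} {M : Matroid α} [M.Finite] {A B X Y : Set α}

/-- If all bases in the face of `X` meet `Y` in `k` elements, then `k` is bounded by the size of
that intersection for a basis extending a basis of `X \ Y`, then of `X`, then of the union of `X`
and the complement of `Y`. -/
theorem add_rk_sdiff_add_rk_union_compl_le (hX : X ⊆ M.E) {k : ℕ}
    (h : ∀ B, M.IsBase B → (B ∩ X).ncard = rk M X → (B ∩ Y).ncard = k) :
    k + rk M (X \ Y) + rk M (X ∪ (M.E \ Y)) ≤ rk M M.E + rk M X := by
  -- The base is built greedily along X \ Y ⊆ X ⊆ X ∪ (E \ Y) ⊆ E: it is tight on X and, subject to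
  -- that, has many elements outside Y, namely I and K \ J.
  obtain ⟨I, hI⟩ := M.exists_isBasis (X \ Y) (sdiff_subset.trans hX)
  obtain ⟨J, hJ, hIJ⟩ := hI.indep.subset_isBasis_of_subset (hI.subset.trans sdiff_subset) hX
  obtain ⟨K, hK, hJK⟩ := hJ.indep.subset_isBasis_of_subset
    (hJ.subset.trans (subset_union_left (t := M.E \ Y))) (union_subset hX sdiff_subset)
  obtain ⟨B, hB, hKB⟩ := hK.indep.exists_isBase_superset
  have hBfin := M.set_finite B hB.subset_ground
  have hJX : J = B ∩ X := hJ.eq_of_subset_indep (hB.indep.inter_right X)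
    (subset_inter (hJK.trans hKB) hJ.subset) inter_subset_right
  have hk := h B hB (by rw [← hJX, ncard_eq_rk_of_isBasis hJ])
  have h1 := ncard_inter_add_ncard_inter_compl hB.subset_ground Y
  have h2 := ncard_eq_rk_ground hB
  have h3 := ncard_eq_rk_of_isBasis hI
  have h4 := ncard_eq_rk_of_isBasis hJ
  have h5 := ncard_eq_rk_of_isBasis hK
  have h6 := ncard_sdiff_add_ncard_of_subset hJK (hBfin.subset hKB)
  have hdisj : Disjoint I (K \ J) := disjoint_sdiff_right.mono_left hIJ
  have h7 := ncard_union_eq hdisj (hBfin.subset (hIJ.trans (hJK.trans hKB)))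
    ((hBfin.subset hKB).subset sdiff_subset)
  have h8 : I ∪ (K \ J) ⊆ B ∩ (M.E \ Y) := by
    rintro x (hx | hx)
    · exact ⟨hKB (hJK (hIJ hx)), hX (hI.subset hx).1, (hI.subset hx).2⟩
    · refine ⟨hKB hx.1, (hK.subset hx.1).resolve_left fun hxX => hx.2 ?_⟩
      rw [hJX]
      exact ⟨hKB hx.1, hxX⟩
  have h9 := ncard_le_ncard h8 (hBfin.subset inter_subset_left)
  omega

/-- If all bases in the face of `X` meet `Y` in the same number of elements, then `Y` induces
separators of the restriction to `X` and of the contraction of `X`. -/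
theorem rk_restrict_contract_le_of_forall_ncard_inter_eq (hX : X ⊆ M.E) {k : ℕ}
    (h : ∀ B, M.IsBase B → (B ∩ X).ncard = rk M X → (B ∩ Y).ncard = k) :
    rk M (X ∩ Y) + rk M (X \ Y) ≤ rk M X ∧
      rk M (X ∪ (M.E ∩ Y)) + rk M (X ∪ (M.E \ Y)) ≤ rk M M.E + rk M X := by
  have h1 := add_rk_sdiff_add_rk_union_compl_le hX h
  obtain ⟨B₀, hB₀, hB₀X⟩ := exists_isBase_ncard_inter (M := M) hX
  have hk : k ≤ rk M M.E := by
    rw [← h B₀ hB₀ hB₀X, ← ncard_eq_rk_ground hB₀]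
    exact ncard_le_ncard inter_subset_left (M.set_finite B₀ hB₀.subset_ground)
  -- Complementary counts are constant too. Adding both inequalities cancels k, and the sum meets
  -- the opposite bounds from subadditivity (`h7`) and submodularity (`h8`), so each of these is
  -- tight.
  have h2 := add_rk_sdiff_add_rk_union_compl_le (Y := M.E \ Y) (k := rk M M.E - k) hX
    fun B hB hBX => by
      have h3 := ncard_inter_add_ncard_inter_compl hB.subset_ground Y
      have h4 := ncard_eq_rk_ground hB
      have h5 := h B hB hBX
      omega
  have h6 : X \ (M.E \ Y) = X ∩ Y := by
    ext x
    have := @hX x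
    simp only [mem_sdiff, mem_inter_iff]
    tauto
  rw [h6, sdiff_sdiff_right_self] at h2
  have h7 := rk_union_le M (X ∩ Y) (X \ Y)
  rw [inter_union_sdiff] at h7
  have h8 := rk_inter_add_rk_union_le M (X ∪ (M.E ∩ Y)) (X ∪ (M.E \ Y))
  have h9 : (X ∪ (M.E ∩ Y)) ∩ (X ∪ (M.E \ Y)) = X := by
    ext x
    simp only [mem_sdiff, mem_inter_iff, mem_union]
    tauto
  have h10 : (X ∪ (M.E ∩ Y)) ∪ (X ∪ (M.E \ Y)) = M.E := by
    ext x
    have := @hX x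
    simp only [mem_sdiff, mem_inter_iff, mem_union]
    tauto
  rw [h9, h10] at h8
  omega

/-- If the restriction to `A` and the contraction of `A` are connected, then only trivial unions
of `A` and its complement meet all bases in the face of `A` in the same number of elements. -/
theorem inter_eq_and_sdiff_eq_of_forall_ncard_inter_eq (hA : A ⊆ M.E) (hY : Y ⊆ M.E)
    (h₁ : IsConnected (M.restrict A)) (h₂ : IsConnected (M.contract A)) {k : ℕ}
    (h : ∀ B, M.IsBase B → (B ∩ A).ncard = rk M A → (B ∩ Y).ncard = k) :
    (A ∩ Y = ∅ ∨ A ∩ Y = A) ∧ (Y \ A = ∅ ∨ Y \ A = M.E \ A) := by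
  obtain ⟨hr, hc⟩ := rk_restrict_contract_le_of_forall_ncard_inter_eq hA h
  rw [isConnected_restrict_iff_rk hA] at h₁
  rw [isConnected_contract_iff_rk hA] at h₂
  refine ⟨h₁.2 _ inter_subset_left (by rwa [sdiff_self_inter]),
    h₂.2 _ (sdiff_subset_sdiff_left hY) ?_⟩
  rw [inter_eq_right.2 hY] at hc
  have : M.E \ (Y \ A) = A ∪ (M.E \ Y) := by
    ext x
    have := @hA x
    simp only [mem_sdiff, mem_union]
    tauto
  rwa [this, union_sdiff_self]

theorem faceOf_baseSystem_ne_iff (hM : IsConnected M) (hA : A ⊆ M.E) :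
    faceOf M (baseSystem M) A ≠ baseSystem M ↔ A.Nonempty ∧ A ≠ M.E := by
  rw [nonempty_iff_ne_empty, ← not_or, not_iff_not]
  constructor
  · intro h
    refine (isConnected_iff_rk.1 hM).2 A hA
      (rk_add_rk_compl_le_of_forall_ncard_inter_eq hA (k := rk M A) fun B hB => ?_)
    rw [← mem_faceOf_baseSystem.trans (and_iff_right hB), h]
    exact hB
  · rintro (rfl | rfl)
    · ext B
      refine mem_faceOf_baseSystem.trans (and_iff_left_of_imp fun _ => ?_)
      simp [rk]
    · ext B
      refine mem_faceOf_baseSystem.trans (and_iff_left_of_imp fun hB => ?_)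
      rw [inter_eq_left.2 hB.subset_ground, ncard_eq_rk_ground hB]

end BaseFaces

/-! ### Facets of the base system: (a) and (c). -/

section BaseFacets

variable {α : Type*} {M : Matroid α} [M.Finite] {A B I X Y : Set α}

/-- Each trace is bounded by a rank, and the separator inequality leaves no slack in the sum. -/
theorem ncard_inter_eq_of_restrict_separator (hXA : X ⊆ A)
    (hr : rk M X + rk M (A \ X) ≤ rk M A) (hI : M.Indep I) (hIA : (I ∩ A).ncard = rk M A) :
    (I ∩ X).ncard = rk M X ∧ (I ∩ (A \ X)).ncard = rk M (A \ X) := by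
  have h1 := ncard_le_rk (hI.inter_right X) inter_subset_right
  have h2 := ncard_le_rk (hI.inter_right (A \ X)) inter_subset_right
  have h3 := ncard_union_le (I ∩ X) (I ∩ (A \ X))
  rw [← inter_union_distrib_left, union_sdiff_cancel hXA] at h3
  omega

theorem ncard_inter_eq_of_contract_separator (hX : X ⊆ M.E \ A)
    (hr : rk M (A ∪ X) + rk M (M.E \ X) ≤ rk M M.E + rk M A) (hB : M.IsBase B)
    (hBA : (B ∩ A).ncard = rk M A) :
    (B ∩ (A ∪ X)).ncard = rk M (A ∪ X) ∧ (B ∩ (M.E \ X)).ncard = rk M (M.E \ X) ∧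
      (B ∩ A).ncard + (B ∩ X).ncard = rk M (A ∪ X) := by
  have hfin := M.set_finite B hB.subset_ground
  have h1 := ncard_le_rk (hB.indep.inter_right (A ∪ X)) inter_subset_right
  have h2 := ncard_le_rk (hB.indep.inter_right (M.E \ X)) inter_subset_right
  have hdisj : Disjoint A X := disjoint_sdiff_right.mono_right hX
  have h3 := ncard_union_eq (hdisj.mono inter_subset_right inter_subset_right :
    Disjoint (B ∩ A) (B ∩ X)) (hfin.subset inter_subset_left) (hfin.subset inter_subset_left)
  have h4 := ncard_inter_add_ncard_inter_compl hB.subset_ground X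
  have h5 := ncard_eq_rk_ground hB
  rw [← inter_union_distrib_left] at h3
  omega

theorem baseFacetDefining_iff (hM : IsConnected M) (hA : A ⊆ M.E) :
    BaseFacetDefining M A ↔ (A.Nonempty ∧ A ≠ M.E) ∧ ∀ Y ⊆ M.E, Y.Nonempty → Y ≠ M.E →
      faceOf M (baseSystem M) A ⊆ faceOf M (baseSystem M) Y →
        faceOf M (baseSystem M) Y ⊆ faceOf M (baseSystem M) A := by
  rw [BaseFacetDefining, isFacet_faceOf_iff hA, faceOf_baseSystem_ne_iff hM hA]
  refine and_congr_right fun _ => forall₂_congr fun Y hY => ?_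
  rw [faceOf_baseSystem_ne_iff hM hY, and_imp]

theorem BaseFacetDefining.isConnected_restrict (h : BaseFacetDefining M A) (hM : IsConnected M)
    (hA : A ⊆ M.E) : IsConnected (M.restrict A) := by
  obtain ⟨⟨hne, hAE⟩, hmax⟩ := (baseFacetDefining_iff hM hA).1 h
  refine (isConnected_restrict_iff_rk hA).2 ⟨hne, fun X hX hr => ?_⟩
  by_contra! hcon
  have hXE : X ⊆ M.E := hX.trans hA
  have hXne : X ≠ M.E := fun h0 => hcon.2 (hX.antisymm (h0 ▸ hA))
  have hle : ∀ B ∈ faceOf M (baseSystem M) X, B ∈ faceOf M (baseSystem M) A :=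
    hmax X hXE hcon.1 hXne fun B hB => by
      rw [mem_faceOf_baseSystem] at hB ⊢
      exact ⟨hB.1, (ncard_inter_eq_of_restrict_separator hX hr hB.1.indep hB.2).1⟩
  -- The faces of X and A now coincide, so the bases of the face of X are constant on A \ X. The
  -- greedy inequality then makes A \ X a separator of M.
  have h1 := add_rk_sdiff_add_rk_union_compl_le (Y := A \ X) (k := rk M (A \ X)) hXE
    fun B hB hBX => by
      have h2 := mem_faceOf_baseSystem.1 (hle B (mem_faceOf_baseSystem.2 ⟨hB, hBX⟩))
      exact (ncard_inter_eq_of_restrict_separator hX hr hB.indep h2.2).2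
  have h3 : X \ (A \ X) = X := by
    ext x
    simp only [mem_sdiff]
    tauto
  have h4 : X ∪ (M.E \ (A \ X)) = M.E \ (A \ X) := by
    refine union_eq_right.2 fun x hx => ⟨hXE hx, fun h => h.2 hx⟩
  rw [h3, h4] at h1
  obtain h5 | h5 := (isConnected_iff_rk.1 hM).2 (A \ X) (sdiff_subset.trans hA) (by omega)
  · exact hcon.2 (hX.antisymm (sdiff_eq_empty.1 h5))
  · exact hAE (hA.antisymm (h5 ▸ sdiff_subset))

theorem BaseFacetDefining.isConnected_contract (h : BaseFacetDefining M A) (hM : IsConnected M)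
    (hA : A ⊆ M.E) : IsConnected (M.contract A) := by
  obtain ⟨⟨hne, hAE⟩, hmax⟩ := (baseFacetDefining_iff hM hA).1 h
  refine (isConnected_contract_iff_rk hA).2
    ⟨nonempty_iff_ne_empty.2 fun h0 => hAE (hA.antisymm (sdiff_eq_empty.1 h0)), fun X hX hr => ?_⟩
  by_contra! hcon
  have hXE : X ⊆ M.E := hX.trans sdiff_subset
  have hAX : A ∪ X ≠ M.E := fun h0 => hcon.2 (hX.antisymm fun x hx =>
    (h0.ge hx.1).resolve_left hx.2)
  have hle : ∀ B ∈ faceOf M (baseSystem M) (A ∪ X), B ∈ faceOf M (baseSystem M) A :=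
    hmax (A ∪ X) (union_subset hA hXE) (hne.mono subset_union_left) hAX fun B hB => by
      rw [mem_faceOf_baseSystem] at hB ⊢
      exact ⟨hB.1, (ncard_inter_eq_of_contract_separator hX hr hB.1 hB.2).1⟩
  -- The faces of A ∪ X and A coincide; constancy on E \ X makes X a separator of M.
  have h1 := add_rk_sdiff_add_rk_union_compl_le (Y := M.E \ X) (k := rk M (M.E \ X))
    (union_subset hA hXE) fun B hB hBX => by
      have h2 := mem_faceOf_baseSystem.1 (hle B (mem_faceOf_baseSystem.2 ⟨hB, hBX⟩))
      exact (ncard_inter_eq_of_contract_separator hX hr hB h2.2).2.1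
  have h3 : (A ∪ X) \ (M.E \ X) = X := by
    ext x
    have := @hA x
    have := @hXE x
    simp only [mem_sdiff, mem_union]
    tauto
  rw [h3, sdiff_sdiff_cancel_left hXE, union_assoc, union_self] at h1
  obtain h5 | h5 := (isConnected_iff_rk.1 hM).2 X hXE (by omega)
  · exact hcon.1.ne_empty h5
  · obtain ⟨x, hx⟩ := hne
    exact (hX (h5.ge (hA hx))).2 hx

theorem baseFacetDefining_of_isConnected (hM : IsConnected M) (hA : A ⊆ M.E)
    (h₁ : IsConnected (M.restrict A)) (h₂ : IsConnected (M.contract A)) :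
    BaseFacetDefining M A := by
  have hne : A.Nonempty := h₁.1
  have hcne : (M.E \ A).Nonempty := h₂.1
  have hAE : A ≠ M.E := by
    rintro h0
    rw [← h0, sdiff_self] at hcne
    exact hcne.ne_empty rfl
  refine (baseFacetDefining_iff hM hA).2 ⟨⟨hne, hAE⟩, fun Y hY hYne hYE hle => ?_⟩
  have hconst : ∀ B, M.IsBase B → (B ∩ A).ncard = rk M A → (B ∩ Y).ncard = rk M Y :=
    fun B hB hBA => (mem_faceOf_baseSystem.1 (hle (mem_faceOf_baseSystem.2 ⟨hB, hBA⟩))).2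
  obtain ⟨h3, h4⟩ := inter_eq_and_sdiff_eq_of_forall_ncard_inter_eq hA hY h₁ h₂ hconst
  have hYeq : Y = (A ∩ Y) ∪ (Y \ A) := by rw [inter_comm, inter_union_sdiff]
  rcases h3 with h3 | h3 <;> rcases h4 with h4 | h4 <;> rw [h3, h4] at hYeq
  · simp [hYeq] at hYne
  · rw [empty_union] at hYeq
    subst hYeq
    -- If Y is the complement of A, tightness on both sides would make A a separator of M.
    have h5 := add_rk_sdiff_add_rk_union_compl_le hA hconst
    have h6 : A \ (M.E \ A) = A := by
      rw [sdiff_sdiff_right, sdiff_eq_empty.2 hA, inter_self, empty_union]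
    rw [h6, sdiff_sdiff_cancel_left hA, union_self] at h5
    obtain h7 | h7 := (isConnected_iff_rk.1 hM).2 A hA (by omega)
    · exact absurd h7 hne.ne_empty
    · exact absurd h7 hAE
  · rw [union_empty] at hYeq
    rw [hYeq]
  · rw [union_sdiff_cancel hA] at hYeq
    exact absurd hYeq hYE

end BaseFacets

/-! ### The face as the base system of a direct sum: (b) and (c). -/

section Components

variable {α : Type*} {M N : Matroid α} [M.Finite] {A B X : Set α}

theorem disjointSum_restrict_contract_isBase_iff (hA : A ⊆ M.E)
    (hd : Disjoint (M.restrict A).E (M.contract A).E) :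
    ((M.restrict A).disjointSum (M.contract A) hd).IsBase B ↔
      M.IsBase B ∧ (B ∩ A).ncard = rk M A := by
  have hrc : rk (M.contract A) (M.contract A).E + rk M A = rk M M.E := by
    have h := rk_contract_add hA (X := M.E \ A) Subset.rfl
    rwa [sdiff_union_of_subset hA] at h
  rw [Matroid.disjointSum_isBase_iff, Matroid.restrict_ground_eq, Matroid.contract_ground,
    Matroid.isBase_restrict_iff hA, union_sdiff_cancel hA]
  constructor
  · rintro ⟨h1, h2, hB⟩
    have h3 := (h1.contract_indep_iff.1 h2.indep).1
    rw [union_comm, ← inter_union_distrib_left, union_sdiff_cancel hA, inter_eq_left.2 hB] at h3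
    have h4 := ncard_inter_add_ncard_inter_compl hB A
    have h5 := ncard_eq_rk_of_isBasis h1
    have h6 := ncard_eq_rk_ground h2
    exact ⟨isBase_of_rk_le_ncard h3 (by omega), h5⟩
  · rintro ⟨hB, hBA⟩
    have h1 : M.IsBasis (B ∩ A) A :=
      isBasis_of_rk_le_ncard (hB.indep.inter_right A) inter_subset_right hA hBA.ge
    have h4 := ncard_inter_add_ncard_inter_compl hB.subset_ground A
    have h5 := ncard_eq_rk_ground hB
    refine ⟨h1, isBase_of_rk_le_ncard (h1.contract_indep_iff.2 ⟨?_, ?_⟩) (by omega),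
      hB.subset_ground⟩
    · rw [← inter_union_distrib_left, sdiff_union_of_subset hA, inter_eq_left.2 hB.subset_ground]
      exact hB.indep
    · exact disjoint_sdiff_right.mono_right inter_subset_right

theorem isSeparator_iff_forall_ncard_inter_eq [N.Finite] :
    IsSeparator N X ↔ X ⊆ N.E ∧ ∃ k, ∀ B, N.IsBase B → (B ∩ X).ncard = k :=
  ⟨fun h => ⟨h.subset_ground, h.exists_forall_ncard_inter_eq⟩, fun ⟨hX, _, hk⟩ =>
    isSeparator_of_rk_add_rk_compl_le hX (rk_add_rk_compl_le_of_forall_ncard_inter_eq hX hk)⟩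

theorem IsBaseSystemWithComponents.isConnected (hA : A ⊆ M.E)
    (h : IsBaseSystemWithComponents M.E (faceOf M (baseSystem M) A) {A, M.E \ A}) :
    IsConnected (M.restrict A) ∧ IsConnected (M.contract A) := by
  obtain ⟨N, hNE, hNB, hNC⟩ := h
  have : N.Finite := ⟨hNE ▸ M.ground_finite⟩
  have hbase : ∀ B, N.IsBase B → M.IsBase B ∧ (B ∩ A).ncard = rk M A := fun B hB =>
    mem_faceOf_baseSystem.1 (hNB.le hB)
  have hminA : Minimal (fun X => X.Nonempty ∧ IsSeparator N X) A := hNC.ge (Or.inl rfl)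
  have hminC : Minimal (fun X => X.Nonempty ∧ IsSeparator N X) (M.E \ A) := hNC.ge (Or.inr rfl)
  constructor
  · refine (isConnected_restrict_iff_rk hA).2 ⟨hminA.prop.1, fun X hX hr => ?_⟩
    refine X.eq_empty_or_nonempty.imp_right fun hne => hminA.eq_of_le ⟨hne, ?_⟩ hX
    refine isSeparator_iff_forall_ncard_inter_eq.2
      ⟨(hX.trans hA).trans hNE.ge, rk M X, fun B hB => ?_⟩
    exact (ncard_inter_eq_of_restrict_separator hX hr (hbase B hB).1.indep (hbase B hB).2).1
  · refine (isConnected_contract_iff_rk hA).2 ⟨hminC.prop.1, fun X hX hr => ?_⟩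
    refine X.eq_empty_or_nonempty.imp_right fun hne => hminC.eq_of_le ⟨hne, ?_⟩ hX
    refine isSeparator_iff_forall_ncard_inter_eq.2
      -- The constant is the rank of X in M/A.
      ⟨(hX.trans sdiff_subset).trans hNE.ge, rk M (A ∪ X) - rk M A, fun B hB => ?_⟩
    have h1 := hbase B hB
    have h2 := (ncard_inter_eq_of_contract_separator hX hr h1.1 h1.2).2.2
    omega

theorem isBaseSystemWithComponents_of_isConnected (hA : A ⊆ M.E)
    (h₁ : IsConnected (M.restrict A)) (h₂ : IsConnected (M.contract A)) :
    IsBaseSystemWithComponents M.E (faceOf M (baseSystem M) A) {A, M.E \ A} := by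
  have hd : Disjoint (M.restrict A).E (M.contract A).E := by
    simpa only [Matroid.restrict_ground_eq, Matroid.contract_ground] using disjoint_sdiff_right
  obtain ⟨N, hN⟩ : ∃ N, N = (M.restrict A).disjointSum (M.contract A) hd := ⟨_, rfl⟩
  have hNE : N.E = M.E := by
    rw [hN, Matroid.disjointSum_ground_eq]
    exact union_sdiff_cancel hA
  have : N.Finite := ⟨hNE ▸ M.ground_finite⟩
  have hbase : ∀ B, N.IsBase B ↔ M.IsBase B ∧ (B ∩ A).ncard = rk M A := fun B =>
    hN ▸ disjointSum_restrict_contract_isBase_iff hA hd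
  have hne : A.Nonempty := h₁.1
  have hcne : (M.E \ A).Nonempty := h₂.1
  have hsepA : IsSeparator N A := ⟨_, _, hd, rfl, hN⟩
  have hsepC : IsSeparator N (M.E \ A) :=
    ⟨_, _, hd.symm, rfl, hN.trans Matroid.disjointSum_comm⟩
  have hsep : ∀ X, IsSeparator N X →
      (A ∩ X = ∅ ∨ A ∩ X = A) ∧ (X \ A = ∅ ∨ X \ A = M.E \ A) := fun X hX => by
    obtain ⟨hXE, k, hk⟩ := isSeparator_iff_forall_ncard_inter_eq.1 hX
    exact inter_eq_and_sdiff_eq_of_forall_ncard_inter_eq hA (hXE.trans hNE.le) h₁ h₂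
      fun B hB hBA => hk B ((hbase B).2 ⟨hB, hBA⟩)
  have hminA : Minimal (fun X => X.Nonempty ∧ IsSeparator N X) A := by
    refine ⟨⟨hne, hsepA⟩, fun X hX hXA => ?_⟩
    obtain h | h := (hsep X hX.2).1 <;> rw [inter_eq_right.2 hXA] at h
    · exact absurd h hX.1.ne_empty
    · exact h.ge
  have hminC : Minimal (fun X => X.Nonempty ∧ IsSeparator N X) (M.E \ A) := by
    refine ⟨⟨hcne, hsepC⟩, fun X hX hXA => ?_⟩
    have hXd : X \ A = X := sdiff_eq_left.2 (disjoint_sdiff_left.mono_left hXA)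
    obtain h | h := (hsep X hX.2).2 <;> rw [hXd] at h
    · exact absurd h hX.1.ne_empty
    · exact h.ge
  refine ⟨N, hNE, ?_, Subset.antisymm (fun X hX => ?_) ?_⟩
  · ext B
    exact (hbase B).trans mem_faceOf_baseSystem.symm
  · have hX' : Minimal (fun X => X.Nonempty ∧ IsSeparator N X) X := hX
    obtain ⟨h3, h4⟩ := hsep X hX'.prop.2
    obtain h3 | h3 := h3
    · right
      obtain h4 | h4 := h4
      · refine absurd ?_ hX'.prop.1.ne_empty
        rw [← inter_union_sdiff X A, inter_comm, h3, h4, union_empty]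
      · exact (hX'.eq_of_le ⟨hcne, hsepC⟩ (h4 ▸ sdiff_subset)).symm
    · exact Or.inl (hX'.eq_of_le ⟨hne, hsepA⟩ (inter_eq_left.1 h3)).symm
  · rintro X (rfl | rfl)
    · exact hminA
    · exact hminC

end Components

/-! ### Facets of the independence system. -/

section IndepFacets

variable {α : Type*} {M : Matroid α} [M.Finite] {A Y : Set α}

theorem faceOf_indepSystem_ne_iff :
    faceOf M (indepSystem M) A ≠ indepSystem M ↔ rk M A ≠ 0 := by
  rw [not_iff_not]
  constructor
  · intro h
    have h0 : ∅ ∈ faceOf M (indepSystem M) A := h.ge M.empty_indep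
    rw [mem_faceOf_indepSystem] at h0
    simpa using h0.2.symm
  · intro h
    ext I
    refine mem_faceOf_indepSystem.trans (and_iff_left_of_imp fun hI => ?_)
    have := ncard_le_rk (hI.inter_right A) inter_subset_right
    omega

theorem indepFacetDefining_iff (hA : A ⊆ M.E) :
    IndepFacetDefining M A ↔ rk M A ≠ 0 ∧ ∀ Y ⊆ M.E, rk M Y ≠ 0 →
      faceOf M (indepSystem M) A ⊆ faceOf M (indepSystem M) Y →
        faceOf M (indepSystem M) Y ⊆ faceOf M (indepSystem M) A := by
  rw [IndepFacetDefining, isFacet_faceOf_iff hA, faceOf_indepSystem_ne_iff]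
  refine and_congr_right fun _ => forall₂_congr fun Y hY => ?_
  rw [faceOf_indepSystem_ne_iff]

/-- A closed set of positive rank whose restriction is connected defines a facet of the
independence system. -/
theorem indepFacetDefining_of_isConnected (hA : A ⊆ M.E) (hr : rk M A ≠ 0)
    (h : IsConnected (M.restrict A)) (hcl : M.closure A ⊆ A) : IndepFacetDefining M A := by
  refine (indepFacetDefining_iff hA).2 ⟨hr, fun Y hY hYr hle => ?_⟩
  have hmem : ∀ I, M.Indep I → (I ∩ A).ncard = rk M A → (I ∩ Y).ncard = rk M Y :=
    fun I hI hIA => (mem_faceOf_indepSystem.1 (hle (mem_faceOf_indepSystem.2 ⟨hI, hIA⟩))).2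
  have hYA : Y ⊆ A := by
    by_contra hcon
    obtain ⟨e, heY, heA⟩ := not_subset.1 hcon
    obtain ⟨J, hJ⟩ := M.exists_isBasis A
    have heJ : e ∉ J := fun h => heA (hJ.subset h)
    have hins : M.Indep (insert e J) := by
      refine (hJ.indep.notMem_closure_iff_of_notMem heJ (hY heY)).1 ?_
      rw [hJ.closure_eq_closure]
      exact fun h => heA (hcl h)
    have h1 := hmem J hJ.indep (by rw [inter_eq_left.2 hJ.subset, ncard_eq_rk_of_isBasis hJ])
    -- Both J and J + e lie in the face of A, yet their traces on Y differ by e.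
    have h2 := hmem _ hins (by
      rw [insert_inter_of_notMem heA, inter_eq_left.2 hJ.subset, ncard_eq_rk_of_isBasis hJ])
    rw [insert_inter_of_mem heY, ncard_insert_of_notMem (fun h => heJ h.1)
      ((M.set_finite J hJ.indep.subset_ground).subset inter_subset_left)] at h2
    omega
  have h3 := (rk_restrict_contract_le_of_forall_ncard_inter_eq hA
    fun B hB hBA => hmem B hB.indep hBA).1
  rw [inter_eq_right.2 hYA] at h3
  obtain h4 | h4 := ((isConnected_restrict_iff_rk hA).1 h).2 Y hYA h3
  · exact absurd (by simp [h4, rk]) hYr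
  · rw [h4]

theorem IndepFacetDefining.isConnected_restrict (h : IndepFacetDefining M A)
    (hM : IsConnected M) (hA : A ⊆ M.E) : IsConnected (M.restrict A) := by
  obtain ⟨hr, hmax⟩ := (indepFacetDefining_iff hA).1 h
  have key : ∀ X ⊆ A, rk M X + rk M (A \ X) ≤ rk M A → rk M X ≠ 0 → X = A := by
    intro X hX hle hXr
    obtain ⟨J, hJ⟩ := M.exists_isBasis X (hX.trans hA)
    have hmem : ∀ I, M.Indep I → (I ∩ X).ncard = rk M X → (I ∩ A).ncard = rk M A := by
      intro I hI hIX
      refine (mem_faceOf_indepSystem.1 (hmax X (hX.trans hA) hXr (fun K hK => ?_)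
        (mem_faceOf_indepSystem.2 ⟨hI, hIX⟩))).2
      rw [mem_faceOf_indepSystem] at hK ⊢
      exact ⟨hK.1, (ncard_inter_eq_of_restrict_separator hX hle hK.1 hK.2).1⟩
    -- A basis of X already lies in the face of A, which forces r(X) = r(A) and leaves A \ X with
    -- rank zero.
    have h1 := hmem J hJ.indep (by rw [inter_eq_left.2 hJ.subset, ncard_eq_rk_of_isBasis hJ])
    rw [inter_eq_left.2 (hJ.subset.trans hX), ncard_eq_rk_of_isBasis hJ] at h1
    by_contra hne
    have hdne : (A \ X).Nonempty :=
      nonempty_iff_ne_empty.2 fun h0 => hne (hX.antisymm (sdiff_eq_empty.1 h0))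
    have h2 := hM.eq_ground_of_rk_eq_zero (sdiff_subset.trans hA) hdne (by omega)
    have h3 := rk_mono M (hX.trans hA)
    rw [← h2] at h3
    omega
  refine (isConnected_restrict_iff_rk hA).2 ⟨?_, fun X hX hle => ?_⟩
  · rw [nonempty_iff_ne_empty]
    rintro rfl
    simp [rk] at hr
  · by_cases hXr : rk M X = 0
    · left
      have h1 := rk_union_le M X (A \ X)
      rw [union_sdiff_cancel hX] at h1
      -- When X has rank zero, the complementary separator A \ X carries all of the positive rank
      -- r(A).
      have h2 := key (A \ X) sdiff_subset (by rw [sdiff_sdiff_cancel_left hX]; omega) (by omega)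
      rw [← sdiff_sdiff_cancel_left hX, h2, sdiff_self]
    · exact Or.inr (key X hX hle hXr)

/-- A proper spanning subset does not define a facet of the independence system. -/
theorem IndepFacetDefining.rk_lt (h : IndepFacetDefining M A) (hM : IsConnected M)
    (hA : A ⊆ M.E) (hne : A ≠ M.E) : rk M A < rk M M.E := by
  obtain ⟨hr, hmax⟩ := (indepFacetDefining_iff hA).1 h
  refine (rk_mono M hA).lt_of_ne fun heq => ?_
  obtain ⟨e, heE, heA⟩ := exists_of_ssubset (hA.ssubset_of_ne hne)
  have he : rk M {e} ≠ 0 := fun h0 => by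
    have h1 := hM.eq_ground_of_rk_eq_zero (singleton_subset_iff.2 heE) (singleton_nonempty e) h0
    rw [← h1] at heq
    omega
  obtain ⟨B, hB, hBe⟩ := exists_isBase_ncard_inter (M := M) (singleton_subset_iff.2 heE)
  have heB : e ∈ B := by
    by_contra hcon
    rw [inter_singleton_eq_empty.2 hcon, ncard_empty] at hBe
    exact he hBe.symm
  -- If A spanned, its face would consist of bases and so lie in the face of E. Maximality would
  -- then put every base inside A, although B contains e.
  have h2 : B ∈ faceOf M (indepSystem M) A := by
    refine hmax M.E Subset.rfl (by omega) (fun I hI => ?_) (mem_faceOf_indepSystem.2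
      ⟨hB.indep, by rw [inter_eq_left.2 hB.subset_ground, ncard_eq_rk_ground hB]⟩)
    rw [mem_faceOf_indepSystem] at hI ⊢
    refine ⟨hI.1, ?_⟩
    have h3 := ncard_le_rk hI.1 hI.1.subset_ground
    have h4 := ncard_le_ncard (inter_subset_left (s := I) (t := A))
      (M.set_finite I hI.1.subset_ground)
    rw [inter_eq_left.2 hI.1.subset_ground]
    omega
  have h5 := (mem_faceOf_indepSystem.1 h2).2
  have h6 : B ∩ A ⊂ B := ⟨inter_subset_left, fun h => heA (h heB).2⟩
  have h7 := ncard_lt_ncard h6 (M.set_finite B hB.subset_ground)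
  have h8 := ncard_eq_rk_ground hB
  omega

/-- A non-spanning set with connected contraction is closed. -/
theorem closure_subset_of_isConnected_contract (hA : A ⊆ M.E) (h : IsConnected (M.contract A))
    (hlt : rk M A < rk M M.E) : M.closure A ⊆ A := by
  intro e he
  by_contra heA
  have heE := M.mem_ground_of_mem_closure he
  have h1 : rk M (A ∪ {e}) = rk M A := by
    rw [rk, rk, ← M.eRk_closure_eq A, ← M.eRk_closure_eq (A ∪ {e}), union_singleton,
      M.closure_insert_eq_of_mem_closure he]
  have h2 : rk M (M.E \ {e}) ≤ rk M M.E := rk_mono M sdiff_subset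
  -- An element of the closure outside A is a loop of M/A, hence by connectedness its whole ground
  -- set, which contradicts r(A) < r(E).
  obtain h3 | h3 := ((isConnected_contract_iff_rk hA).1 h).2 {e}
    (singleton_subset_iff.2 ⟨heE, heA⟩) (by omega)
  · exact singleton_ne_empty e h3
  · rw [h3, union_sdiff_cancel hA] at h1
    omega

end IndepFacets

/-! ### Non-triviality, duality and condition (d). -/

section NonTrivial

variable {α : Type*} {M : Matroid α} [M.Finite] {A : Set α}

theorem nonTrivialIneq_iff (hA : A ⊆ M.E) :
    NonTrivialIneq M A ↔ (rk M A < rk M M.E ∧ rk M A < A.ncard) ∧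
      rk M M.E < rk M A + (M.E \ A).ncard ∧ 0 < rk M A := by
  have hGT : ∀ I, I ∈ levelEq M.E M.E (M.eRk M.E) ∩ levelGT M.E A (M.eRk A) ↔
      I ⊆ M.E ∧ I.ncard = rk M M.E ∧ rk M A < (I ∩ A).ncard := fun I => by
    refine ⟨fun ⟨h1, h2⟩ => ⟨h1.1, ?_, ?_⟩, fun ⟨h1, h2, h3⟩ => ⟨?_, h1, ?_⟩⟩
    · have h3 := (mem_levelEq_iff h1.1).1 h1
      rwa [inter_eq_left.2 h1.1] at h3
    · have h3 := h2.2
      rw [← coe_rk, ← coe_ncard (M := M) (inter_subset_left.trans h1.1)] at h3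
      exact_mod_cast h3
    · rwa [mem_levelEq_iff h1, inter_eq_left.2 h1]
    · rw [← coe_rk, ← coe_ncard (M := M) (inter_subset_left.trans h1)]
      exact_mod_cast h3
  have hLT : ∀ I, I ∈ levelEq M.E M.E (M.eRk M.E) ∩ levelLT M.E A (M.eRk A) ↔
      I ⊆ M.E ∧ I.ncard = rk M M.E ∧ (I ∩ A).ncard < rk M A := fun I => by
    refine ⟨fun ⟨h1, h2⟩ => ⟨h1.1, ?_, ?_⟩, fun ⟨h1, h2, h3⟩ => ⟨?_, h1, ?_⟩⟩
    · have h3 := (mem_levelEq_iff h1.1).1 h1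
      rwa [inter_eq_left.2 h1.1] at h3
    · have h3 := h2.2
      rw [← coe_rk, ← coe_ncard (M := M) (inter_subset_left.trans h1.1)] at h3
      exact_mod_cast h3
    · rwa [mem_levelEq_iff h1, inter_eq_left.2 h1]
    · rw [← coe_rk, ← coe_ncard (M := M) (inter_subset_left.trans h1)]
      exact_mod_cast h3
  have hE : rk M M.E ≤ M.E.ncard := rk_le_ncard Subset.rfl
  have hAfin := M.set_finite A hA
  have hCfin : (M.E \ A).Finite := M.set_finite _ sdiff_subset
  refine and_congr ⟨fun ⟨I, hI⟩ => ?_, fun ⟨h1, h2⟩ => ?_⟩ ⟨fun ⟨I, hI⟩ => ?_, fun ⟨h1, h2⟩ => ?_⟩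
  · obtain ⟨h1, h2, h3⟩ := (hGT I).1 hI
    have h4 := ncard_le_ncard (inter_subset_right (s := I) (t := A)) hAfin
    have h5 := ncard_le_ncard (inter_subset_left (s := I) (t := A)) (M.set_finite I h1)
    omega
  · obtain ⟨T, hTA, hT⟩ := exists_subset_card_eq (s := A) (n := rk M A + 1) h2
    obtain ⟨I, hTI, hIE, hI⟩ := exists_subsuperset_card_eq (hTA.trans hA)
      (hT.trans_le (Nat.succ_le_of_lt h1)) hE
    refine ⟨I, (hGT I).2 ⟨hIE, hI, ?_⟩⟩
    have h3 := ncard_le_ncard (subset_inter hTI hTA) (hAfin.subset inter_subset_right)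
    omega
  · obtain ⟨h1, h2, h3⟩ := (hLT I).1 hI
    have h4 := ncard_inter_add_ncard_inter_compl h1 A
    have h5 := ncard_le_ncard (inter_subset_right (s := I) (t := M.E \ A)) hCfin
    omega
  -- Filling the complement of A as far as r(E) allows makes the trace on A as small as possible.
  · obtain ⟨T, hTA, hT⟩ := exists_subset_card_eq (s := M.E \ A)
      (n := min (rk M M.E) (M.E \ A).ncard) (min_le_right _ _)
    obtain ⟨I, hTI, hIE, hI⟩ := exists_subsuperset_card_eq (hTA.trans sdiff_subset)
      (hT.trans_le (min_le_left _ _)) hE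
    refine ⟨I, (hLT I).2 ⟨hIE, hI, ?_⟩⟩
    have h3 := ncard_le_ncard (subset_inter hTI hTA) (hCfin.subset inter_subset_right)
    have h4 := ncard_inter_add_ncard_inter_compl hIE A
    omega

theorem indepFacetDefining_and_dual_of_isConnected (hA : A ⊆ M.E) (hnt : NonTrivialIneq M A)
    (h₁ : IsConnected (M.restrict A)) (h₂ : IsConnected (M.contract A)) :
    IndepFacetDefining M A ∧ IndepFacetDefining M.dual (M.E \ A) := by
  obtain ⟨⟨hlt, hltA⟩, hltC, hpos⟩ := (nonTrivialIneq_iff hA).1 hnt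
  have hd := rk_dual_add (M := M) (X := M.E \ A) sdiff_subset
  have hdE := rk_dual_add (M := M) (X := M.E) Subset.rfl
  have hn := ncard_sdiff_add_ncard_of_subset hA (M.set_finite _ Subset.rfl)
  rw [sdiff_sdiff_cancel_left hA] at hd
  have hd₁ := isConnected_dual_restrict_compl.2 h₂
  have hd₂ := (isConnected_dual_contract_compl hA).2 h₁
  refine ⟨indepFacetDefining_of_isConnected hA hpos.ne' h₁
    (closure_subset_of_isConnected_contract hA h₂ hlt),
    indepFacetDefining_of_isConnected (M := M.dual) sdiff_subset (by omega) hd₁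
      (closure_subset_of_isConnected_contract (M := M.dual) sdiff_subset hd₂ ?_)⟩
  rw [Matroid.dual_ground]
  omega

theorem isConnected_of_indepFacetDefining_and_dual (hM : IsConnected M) (hA : A ⊆ M.E)
    (h : IndepFacetDefining M A ∧ IndepFacetDefining M.dual (M.E \ A)) :
    IsConnected (M.restrict A) ∧ IsConnected (M.contract A) :=
  ⟨h.1.isConnected_restrict hM hA,
    isConnected_dual_restrict_compl.1 (h.2.isConnected_restrict hM.dual sdiff_subset)⟩

/-- A facet has positive rank and, unless it comes from E, is not spanning. These two facts for A in
M and for its complement in M* are the four required inequalities. -/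
theorem nonTrivialIneq_of_indepFacetDefining_and_dual (hM : IsConnected M) (hA : A ⊆ M.E)
    (h : IndepFacetDefining M A ∧ IndepFacetDefining M.dual (M.E \ A)) :
    NonTrivialIneq M A := by
  obtain ⟨h₁, h₂⟩ := h
  have hr := ((indepFacetDefining_iff hA).1 h₁).1
  have hrC := ((indepFacetDefining_iff (M := M.dual) sdiff_subset).1 h₂).1
  rw [Matroid.dual_ground] at hrC
  have hAE : A ≠ M.E := by
    rintro h0
    rw [h0, sdiff_self] at hrC
    simp [rk] at hrC
  have hCE : M.E \ A ≠ M.dual.E := by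
    intro h0
    rw [Matroid.dual_ground, sdiff_eq_left, disjoint_iff_inter_eq_empty, inter_eq_right.2 hA] at h0
    simp [h0, rk] at hr
  have hlt := h₁.rk_lt hM hA hAE
  have hltC := h₂.rk_lt hM.dual sdiff_subset hCE
  have hd := rk_dual_add (M := M) (X := M.E \ A) sdiff_subset
  have hdE := rk_dual_add (M := M) (X := M.E) Subset.rfl
  have hn := ncard_sdiff_add_ncard_of_subset hA (M.set_finite _ Subset.rfl)
  have h0 : rk M (M.E \ M.E) = 0 := by simp [rk]
  rw [sdiff_sdiff_cancel_left hA] at hd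
  rw [Matroid.dual_ground] at hltC
  refine (nonTrivialIneq_iff hA).2 ⟨⟨hlt, ?_⟩, ?_, ?_⟩ <;> omega

end NonTrivial

end MatroidFacet

theorem theorem2p5 {α : Type*} (M : Matroid α) (hfin : M.E.Finite)
    (hM : MatroidFacet.IsConnected M) (A : Set α) (hA : A ⊆ M.E) :
    List.TFAE
      [MatroidFacet.BaseFacetDefining M A,
       MatroidFacet.IsBaseSystemWithComponents M.E
         (MatroidFacet.faceOf M (MatroidFacet.baseSystem M) A) {A, M.E \ A},
       MatroidFacet.IsConnected (M.restrict A) ∧ MatroidFacet.IsConnected (M.contract A)] ∧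
    (MatroidFacet.NonTrivialIneq M A →
      List.TFAE
        [MatroidFacet.BaseFacetDefining M A,
         MatroidFacet.IsBaseSystemWithComponents M.E
           (MatroidFacet.faceOf M (MatroidFacet.baseSystem M) A) {A, M.E \ A},
         MatroidFacet.IsConnected (M.restrict A) ∧ MatroidFacet.IsConnected (M.contract A),
         MatroidFacet.IndepFacetDefining M A ∧
           MatroidFacet.IndepFacetDefining M.dual (M.E \ A)]) ∧
    (MatroidFacet.IndepFacetDefining M A ∧ MatroidFacet.IndepFacetDefining M.dual (M.E \ A) →
      MatroidFacet.NonTrivialIneq M A) := by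
  have : M.Finite := ⟨hfin⟩
  open MatroidFacet in
  have hac : BaseFacetDefining M A ↔ IsConnected (M.restrict A) ∧ IsConnected (M.contract A) :=
    ⟨fun h => ⟨h.isConnected_restrict hM hA, h.isConnected_contract hM hA⟩,
      fun h => baseFacetDefining_of_isConnected hM hA h.1 h.2⟩
  open MatroidFacet in
  have hbc : IsBaseSystemWithComponents M.E (faceOf M (baseSystem M) A) {A, M.E \ A} ↔
      IsConnected (M.restrict A) ∧ IsConnected (M.contract A) :=
    ⟨fun h => h.isConnected hA, fun h => isBaseSystemWithComponents_of_isConnected hA h.1 h.2⟩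
  -- The last conjunct is the contrapositive form of the failure of (d) without non-triviality.
  refine ⟨?_, fun hnt => ?_, MatroidFacet.nonTrivialIneq_of_indepFacetDefining_and_dual hM hA⟩
  · tfae_have 1 ↔ 3 := hac
    tfae_have 2 ↔ 3 := hbc
    tfae_finish
  · tfae_have 1 ↔ 3 := hac
    tfae_have 2 ↔ 3 := hbc
    tfae_have 3 → 4 := fun h =>
      MatroidFacet.indepFacetDefining_and_dual_of_isConnected hA hnt h.1 h.2
    tfae_have 4 → 3 := MatroidFacet.isConnected_of_indepFacetDefining_and_dual hM hA
    tfae_finish
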